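/- For all positive integers $n$ and non-negative integers $k$, let $A=(A_{i,j})_{0\le i,j\le n-1}$ be the matrix with $A_{0,0}=0$ and $$A_{i,j}=\frac{2k+2}{i+j+k+1}\binom{2i+2j-1}{i+j+k}\qquad\text{for }(i,j)\ne(0,0).$$ Then $$\det_{0\le i,j\le n-1}(A_{i,j})=\begin{cases} (-1)^{n_1\binom{k+1}{2}+1}(n_1-1), & \text{if } n=(k+1)n_1,\\ (-1)^{n_1\binom{k+1}{2}+k+1}\,n_1, & \text{if } n=(k+1)n_1+1,\\ 0, & \text{if } n\not\equiv 0,1 \pmod{k+1}, \end{cases}$$ where $n_1$ denotes a non-negative integer. (For $k=0$ both of the first two cases apply, and they give the same value.) -/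

import Mathlib

/-- The `n × n` rational matrix, with rows and columns indexed by `0, …, n - 1`, whose `(i, j)` entry
is `(2k+2)/(i+j+k+1) * binom(2i+2j-1, i+j+k)`, except that the `(0, 0)` entry is `0` by definition.
(Away from `(0, 0)` one has `2i+2j-1 ≥ 1`, so the subtraction in `ℕ` is the true one.) -/
def ballotHankel (n k : ℕ) : Matrix (Fin n) (Fin n) ℚ :=
  Matrix.of fun i j =>
    if (i : ℕ) = 0 ∧ (j : ℕ) = 0 then 0
    else (2 * (k : ℚ) + 2) / (((i : ℕ) : ℚ) + ((j : ℕ) : ℚ) + (k : ℚ) + 1)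
      * (Nat.choose (2 * (i : ℕ) + 2 * (j : ℕ) - 1) ((i : ℕ) + (j : ℕ) + k) : ℚ)

/- Put `K = k + 1`. Under `X = T + T⁻¹` one has `X + 2 = (T + 1) ^ 2 * T⁻¹`, and the matrix becomes
the Gram matrix, at the powers of `X + 2`, of the functional sending `f` to the constant term of
`T ^ (-K) * (1 - T⁻¹) * f / (1 + T⁻¹)`. Its determinant is the same for any other two monic bases.
All rows but the first are taken divisible by `T + 1`, which cancels the denominator, and the
columns are taken in blocks of length `K`, built on the Chebyshev-type polynomials
`(T ^ ((a+1) * K) - T ^ (-(a+1) * K)) / (T ^ K - T ^ (-K))`. Antisymmetry under `T ↦ T⁻¹` then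
evaluates every entry: away from the first row the matrix is sparse and becomes triangular once each
block of columns is reversed, and the first row carries the factor `n₁` or `n₁ - 1`. -/

section Determinants

open Matrix Polynomial

variable {R : Type*} [CommRing R]

theorem det_linearMap₂_isMonicOfDegree {n : ℕ} (B : R[X] →ₗ[R] R[X] →ₗ[R] R) {p q : Fin n → R[X]}
    (hp : ∀ i, IsMonicOfDegree (p i) i) (hq : ∀ i, IsMonicOfDegree (q i) i) :
    (of fun i j => B (p i) (q j)).det =
      (of fun i j : Fin n => B (X ^ (i : ℕ)) (X ^ (j : ℕ))).det := by
  let coeffs (r : Fin n → R[X]) : Matrix (Fin n) (Fin n) R := of fun s i => (r i).coeff s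
  have det_coeffs {r : Fin n → R[X]} (hr : ∀ i, IsMonicOfDegree (r i) i) : (coeffs r).det = 1 :=
    det_matrixOfPolynomials r (fun i => (hr i).natDegree_eq) (fun i => (hr i).monic)
  have expand {r : Fin n → R[X]} (hr : ∀ i, IsMonicOfDegree (r i) i) (i : Fin n) :
      r i = ∑ s : Fin n, (r i).coeff s • X ^ (s : ℕ) := by
    conv_lhs => rw [(r i).as_sum_range' n ((hr i).natDegree_eq ▸ i.2), Finset.sum_range]
    simp only [smul_X_eq_monomial]
  have congruence : (of fun i j => B (p i) (q j)) =
      (coeffs p)ᵀ * (of fun i j : Fin n => B (X ^ (i : ℕ)) (X ^ (j : ℕ))) * coeffs q := by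
    ext i j
    rw [of_apply, expand hp i, expand hq j, Matrix.mul_assoc]
    simp only [map_sum, map_smul, LinearMap.sum_apply, LinearMap.smul_apply, mul_apply,
      Finset.mul_sum, smul_eq_mul, transpose_apply, of_apply, coeffs]
    rw [Finset.sum_comm]
    exact Finset.sum_congr rfl fun s _ => Finset.sum_congr rfl fun t _ => by ring
  rw [congruence, det_mul, det_mul, det_transpose, det_coeffs hp, det_coeffs hq, one_mul, mul_one]

theorem det_eq_of_column_eq_zero {n : ℕ} {A : Matrix (Fin (n + 1)) (Fin (n + 1)) R}
    (r c : Fin (n + 1)) (h : ∀ i ≠ r, A i c = 0) :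
    A.det = (-1) ^ (r + c : ℕ) * A r c * (A.submatrix r.succAbove c.succAbove).det := by
  rw [det_succ_column A c]
  exact Fintype.sum_eq_single r fun i hi => by rw [h i hi, mul_zero, zero_mul]

theorem det_eq_zero_of_two_columns {n : ℕ} {A : Matrix (Fin n) (Fin n) R} {c d : Fin n}
    (hcd : d ≠ c) (r : Fin n) (hc : ∀ i ≠ r, A i c = 0) (hd : ∀ i ≠ r, A i d = 0) :
    A.det = 0 := by
  obtain _ | n := n
  · exact c.elim0
  obtain ⟨e, rfl⟩ := Fin.exists_succAbove_eq hcd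
  rw [det_eq_of_column_eq_zero r c hc,
    det_eq_zero_of_column_eq_zero e fun i => hd _ (r.succAbove_ne i), mul_zero]

theorem det_eq_of_row_shift {n : ℕ} {A B : Matrix (Fin (n + 1)) (Fin (n + 1)) R}
    (shift : ∀ (i : Fin n) j, A i.succ j = B i.castSucc j) (c : Fin (n + 1))
    (hA : ∀ i ≠ 0, A i c = 0) (hB : ∀ i ≠ Fin.last n, B i c = 0) (hBc : B (Fin.last n) c = 1) :
    A.det = (-1) ^ n * A 0 c * B.det := by
  have minor_eq : A.submatrix (Fin.succAbove 0) c.succAbove =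
      B.submatrix (Fin.last n).succAbove c.succAbove := by
    ext i j
    simpa using shift i (c.succAbove j)
  have sign : (-1 : R) ^ n * (-1) ^ n = 1 := by rw [← mul_pow]; simp
  rw [det_eq_of_column_eq_zero 0 c hA, det_eq_of_column_eq_zero _ c hB, minor_eq, hBc,
    Fin.val_zero, Fin.val_last, zero_add, pow_add]
  linear_combination (-(-1) ^ (c : ℕ) * A 0 c *
    (B.submatrix (Fin.last n).succAbove c.succAbove).det) * sign

theorem det_eq_sign_of_triangular_comp_perm {n : Type*} [Fintype n] [LinearOrder n]
    {A : Matrix n n R} (σ : Equiv.Perm n) (one : ∀ j, A (σ j) j = 1)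
    (zero : ∀ i j, i < σ j → A i j = 0) :
    A.det = (Equiv.Perm.sign σ : ℤ) := by
  have triangular : (A.submatrix id σ.symm).IsLowerTriangular := fun i j hij =>
    zero _ _ (by simpa using hij)
  have det_one : (A.submatrix id σ.symm).det = 1 := by
    rw [det_of_isLowerTriangular _ triangular]
    exact Finset.prod_eq_one fun i _ => by simpa using one (σ.symm i)
  rw [← mul_one ((Equiv.Perm.sign σ : ℤ) : R), ← det_one, ← det_permute', submatrix_submatrix]
  simp

end Determinants

section BlockReversal

theorem sign_finRevPerm (n : ℕ) :
    Equiv.Perm.sign (Fin.revPerm : Equiv.Perm (Fin n)) = (-1) ^ n.choose 2 := by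
  suffices h : (Fin.revPerm.permMatrix ℤ : Matrix (Fin n) (Fin n) ℤ).det = (-1) ^ n.choose 2 by
    rw [Matrix.det_permutation] at h
    exact Units.ext (by simpa using h)
  induction n with
  | zero => rw [Matrix.det_isEmpty, Nat.choose_zero_succ, pow_zero]
  | succ n ih =>
    have minor_eq : ((Fin.revPerm : Equiv.Perm (Fin (n + 1))).permMatrix ℤ).submatrix
        (Fin.last n).succAbove (Fin.succAbove 0) = Fin.revPerm.permMatrix ℤ := by
      ext i j
      simp [PEquiv.toMatrix_apply, Fin.rev_castSucc]
    rw [det_eq_of_column_eq_zero (Fin.last n) 0, minor_eq, ih]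
    · simp [PEquiv.toMatrix_apply, Nat.choose_succ_succ' n 1, pow_add]
    · intro i hi
      simpa [PEquiv.toMatrix_apply, Fin.rev_eq_iff] using hi

/-- The permutation of `Fin (m * n)` reversing each of the `m` consecutive blocks of length `n`. -/
def blockRevPerm (m n : ℕ) : Equiv.Perm (Fin (m * n)) :=
  finProdFinEquiv.permCongr (Equiv.prodCongrRight fun _ => Fin.revPerm)

theorem sign_blockRevPerm (m n : ℕ) :
    Equiv.Perm.sign (blockRevPerm m n) = (-1) ^ (m * n.choose 2) := by
  rw [blockRevPerm, Equiv.Perm.sign_permCongr, Equiv.Perm.sign_prodCongrRight, Finset.prod_const,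
    Finset.card_univ, Fintype.card_fin, sign_finRevPerm, ← pow_mul, mul_comm]

theorem blockRevPerm_val (m n : ℕ) (j : Fin (m * n)) :
    (blockRevPerm m n j : ℕ) = (j : ℕ) / n * n + (n - 1 - (j : ℕ) % n) := by
  rw [show (blockRevPerm m n j : ℕ) = n - ((j : ℕ) % n + 1) + n * ((j : ℕ) / n) from rfl]
  rw [mul_comm n, add_comm, add_comm _ 1, Nat.sub_add_eq]

end BlockReversal

section Chebyshev

open Polynomial

variable (R : Type*) [CommRing R]

theorem isMonicOfDegree_chebyshevS [Nontrivial R] (n : ℕ) :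
    IsMonicOfDegree (Chebyshev.S R n) n := by
  induction n using Nat.twoStepInduction with
  | zero => simp
  | one => simpa using isMonicOfDegree_X R
  | more n ih₀ ih₁ =>
    have h := ((isMonicOfDegree_X R).mul ih₁).sub (q := Chebyshev.S R n)
      (by rw [ih₀.natDegree_eq]; lia)
    rw [show 1 + (n + 1) = n + 2 by ring] at h
    simpa using h

theorem chebyshevS_add_two (n : ℤ) :
    Chebyshev.S R (n + 2) = Chebyshev.S R n + Chebyshev.C R (n + 2) := by
  have h := Chebyshev.S_eq_X_mul_S_add_C R (n + 1)
  rw [add_assoc, one_add_one_eq_two] at h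
  linear_combination h - Chebyshev.S_add_two R n

theorem isMonicOfDegree_chebyshevC [Nontrivial R] {n : ℕ} (hn : n ≠ 0) :
    IsMonicOfDegree (Chebyshev.C R n) n := by
  obtain _ | _ | n := n
  · exact (hn rfl).elim
  · simpa using isMonicOfDegree_X R
  · have h : Chebyshev.C R (n + 2 : ℕ) = Chebyshev.S R (n + 2 : ℕ) - Chebyshev.S R n := by
      push_cast
      rw [chebyshevS_add_two, add_sub_cancel_left]
    rw [h]
    refine (isMonicOfDegree_chebyshevS R (n + 2)).sub ?_
    rw [(isMonicOfDegree_chebyshevS R n).natDegree_eq]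
    lia

variable {R} {A : Type*} [CommRing A] [Algebra R A] {x y : A}

theorem aeval_add_chebyshevC (h : x * y = 1) (n : ℕ) :
    aeval (x + y) (Chebyshev.C R n) = x ^ n + y ^ n := by
  induction n using Nat.twoStepInduction with
  | zero => simp [one_add_one_eq_two, map_ofNat]
  | one => simp
  | more n ih₀ ih₁ =>
    push_cast at ih₁ ⊢
    rw [Chebyshev.C_add_two, map_sub, map_mul, aeval_X, ih₀, ih₁]
    linear_combination (x ^ n + y ^ n) * h

theorem sub_mul_aeval_add_chebyshevS (h : x * y = 1) (n : ℕ) :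
    (x - y) * aeval (x + y) (Chebyshev.S R n) = x ^ (n + 1) - y ^ (n + 1) := by
  induction n using Nat.twoStepInduction with
  | zero => simp
  | one =>
    rw [Nat.cast_one, Chebyshev.S_one, aeval_X]
    ring
  | more n ih₀ ih₁ =>
    push_cast at ih₁ ⊢
    rw [Chebyshev.S_add_two, map_sub, map_mul, aeval_X]
    linear_combination (x + y) * ih₁ - ih₀ + (x ^ (n + 1) - y ^ (n + 1)) * h

theorem sub_one_mul_aeval_add_chebyshevS (h : x * y = 1) (n : ℕ) :
    (x - 1) * aeval (x + y) (Chebyshev.S R n + Chebyshev.S R (n - 1)) = x ^ (n + 1) - y ^ n := by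
  induction n using Nat.twoStepInduction with
  | zero => simp
  | one =>
    simp only [Nat.cast_one, Chebyshev.S_one, sub_self, Chebyshev.S_zero, map_add, aeval_X, map_one]
    linear_combination h
  | more n ih₀ ih₁ =>
    push_cast at ih₁ ⊢
    rw [show (n : ℤ) + 2 - 1 = n - 1 + 2 by ring, Chebyshev.S_add_two,
      Chebyshev.S_add_two R (n - 1), sub_add_cancel]
    rw [show (n : ℤ) + 1 - 1 = n by ring] at ih₁
    simp only [map_add, map_sub, map_mul, aeval_X] at ih₀ ih₁ ⊢
    linear_combination (x + y) * ih₁ - ih₀ + (x ^ (n + 1) - y ^ n) * h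

end Chebyshev

section Laurent

open Polynomial LaurentPolynomial

variable {R : Type*} [CommRing R]

theorem T_mul_T_neg (n : ℤ) : (T n * T (-n) : R[T;T⁻¹]) = 1 := by
  rw [← T_add, add_neg_cancel, T_zero]

theorem coeff_T_mul (f : R[T;T⁻¹]) (m n : ℤ) : (T n * f).coeff m = f.coeff (m - n) := by
  rw [T, AddMonoidAlgebra.coeff_single_mul_apply, one_mul, neg_add_eq_sub]

theorem coeff_T_one_add_one_pow (m n : ℕ) :
    ((T 1 + 1 : R[T;T⁻¹]) ^ n).coeff m = n.choose m := by
  have h : (T 1 + 1 : R[T;T⁻¹]) ^ n = toLaurent ((X + 1) ^ n) := by simp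
  rw [h, coeff_toLaurent, ← coeff_X_add_one_pow]
  exact Finsupp.mapDomain_apply Nat.castEmbedding.injective _ _

theorem invert_aeval_T_add_T_neg (n : ℤ) (p : R[X]) :
    invert (aeval (T n + T (-n) : R[T;T⁻¹]) p) = aeval (T n + T (-n)) p := by
  rw [← aeval_algHom_apply (invert (R := R)), map_add, invert_T, invert_T, neg_neg, add_comm]

theorem coeff_mul_aeval_chebyshevS [IsAddTorsionFree R] {h : R[T;T⁻¹]} (hh : invert h = -h)
    (m : ℤ) (n : ℕ) :
    (aeval (T m + T (-m)) (Chebyshev.S R n) * h).coeff m = h.coeff ((n + 1) * m) := by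
  set f := aeval (T m + T (-m)) (Chebyshev.S R n) * h with hf
  have f_neg (j : ℤ) : f.coeff (-j) = -f.coeff j := by
    rw [← invert_apply, hf, map_mul, invert_aeval_T_add_T_neg, hh, mul_neg]
    rfl
  have h_neg (j : ℤ) : h.coeff (-j) = -h.coeff j := by
    rw [← invert_apply, hh]
    rfl
  have key : (T m - T (-m)) * f = (T ((n + 1) * m) - T (-((n + 1) * m))) * h := by
    rw [hf, ← mul_assoc, sub_mul_aeval_add_chebyshevS (T_mul_T_neg m), T_pow, T_pow]
    push_cast
    rw [mul_neg]
  have key₀ := congrArg (fun g : R[T;T⁻¹] => g.coeff 0) key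
  simp only [sub_mul, AddMonoidAlgebra.coeff_sub, Finsupp.sub_apply, coeff_T_mul, zero_sub,
    neg_neg, f_neg, h_neg] at key₀
  refine nsmul_right_injective two_ne_zero ?_
  dsimp only
  rw [two_nsmul, two_nsmul]
  linear_combination -key₀

end Laurent

section Functional

open Polynomial LaurentPolynomial

/-- The value at `-1` of the part of a Laurent polynomial with nonnegative exponents. It is the
constant term of `f / (1 + T⁻¹)`, the quotient being expanded in powers of `T⁻¹`. -/
noncomputable def nonnegPartEvalNegOne : ℚ[T;T⁻¹] →ₗ[ℚ] ℚ :=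
  Finsupp.linearCombination ℚ (fun n : ℤ => if 0 ≤ n then (-1) ^ n else 0) ∘ₗ
    (AddMonoidAlgebra.coeffLinearEquiv ℚ).toLinearMap

theorem nonnegPartEvalNegOne_T (n : ℤ) :
    nonnegPartEvalNegOne (T n) = if 0 ≤ n then (-1) ^ n else 0 := by
  change Finsupp.linearCombination ℚ _ (Finsupp.single n 1) = _
  rw [Finsupp.linearCombination_single, one_smul]

theorem nonnegPartEvalNegOne_T_one_add_one_mul (f : ℚ[T;T⁻¹]) :
    nonnegPartEvalNegOne ((T 1 + 1) * f) = f.coeff (-1) := by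
  induction f using LaurentPolynomial.induction_on' with
  | add p q hp hq => simp [mul_add, hp, hq]
  | C_mul_T n a =>
    rw [← LaurentPolynomial.smul_eq_C_mul, mul_smul_comm, map_smul, add_mul, one_mul, ← T_add,
      map_add, nonnegPartEvalNegOne_T, nonnegPartEvalNegOne_T, AddMonoidAlgebra.coeff_smul,
      Finsupp.smul_apply, T_apply, add_comm 1 n]
    congr 1
    obtain h | rfl | h := lt_trichotomy n (-1)
    · rw [if_neg (by lia), if_neg (by lia), if_neg (by lia), add_zero]
    · simp
    · rw [if_pos (by lia), if_pos (by lia), if_neg (by lia), zpow_add_one₀ (by norm_num)]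
      ring

/-- The linear functional on polynomials in `X = T + T⁻¹` whose moments at the powers of `X + 2`
are the entries of `ballotHankel n k`, for `K = k + 1`. -/
noncomputable def ballotFunctional (K : ℕ) : ℚ[X] →ₗ[ℚ] ℚ :=
  nonnegPartEvalNegOne ∘ₗ LinearMap.mulLeft ℚ (T (-K - 1) * (T 1 - 1)) ∘ₗ
    (aeval (T 1 + T (-1))).toLinearMap

theorem ballotFunctional_apply (K : ℕ) (p : ℚ[X]) :
    ballotFunctional K p =
      nonnegPartEvalNegOne (T (-K - 1) * (T 1 - 1) * aeval (T 1 + T (-1)) p) := rfl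

theorem ballotFunctional_one {K : ℕ} (hK : 0 < K) : ballotFunctional K 1 = 0 := by
  rw [ballotFunctional_apply, map_one, mul_one, mul_sub, mul_one, ← T_add, map_sub,
    nonnegPartEvalNegOne_T, nonnegPartEvalNegOne_T, if_neg (by lia), if_neg (by lia), sub_zero]

theorem ballotFunctional_eq_coeff (K : ℕ) {p : ℚ[X]} {g : ℚ[T;T⁻¹]}
    (h : aeval (T 1 + T (-1)) p = (T 1 + 1) * g) :
    ballotFunctional K p = ((T 1 - 1) * g).coeff K := by
  rw [ballotFunctional_apply, h, show T (-K - 1) * (T 1 - 1) * ((T 1 + 1) * g) =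
      (T 1 + 1) * (T (-K - 1) * ((T 1 - 1) * g)) by ring,
    nonnegPartEvalNegOne_T_one_add_one_mul, coeff_T_mul]
  congr 1
  ring

theorem aeval_X_add_two_pow_succ (m : ℕ) :
    aeval (T 1 + T (-1) : ℚ[T;T⁻¹]) ((X + 2) ^ (m + 1) : ℚ[X]) =
      (T 1 + 1) * (T (-(m + 1)) * (T 1 + 1) ^ (2 * m + 1)) := by
  have square : (T 1 + T (-1) + 2 : ℚ[T;T⁻¹]) = T (-1) * (T 1 + 1) ^ 2 := by
    linear_combination (-T 1 - 2) * T_mul_T_neg (R := ℚ) 1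
  rw [map_pow, map_add, aeval_X, map_ofNat, square, mul_pow, T_pow, ← pow_mul]
  push_cast
  rw [mul_neg_one]
  ring

theorem ballot_choose_sub (k m : ℕ) :
    ((2 * m + 1).choose (m + k + 1) : ℚ) - (2 * m + 1).choose (m + k + 2) =
      (2 * k + 2) / (m + k + 2) * (2 * m + 1).choose (m + k + 1) := by
  have ratio : ((2 * m + 1).choose (m + k + 2) : ℚ) * (m + k + 2) =
      (2 * m + 1).choose (m + k + 1) * (m - k) := by
    obtain h | h := le_or_gt k m
    · have e := congrArg (Nat.cast : ℕ → ℚ) (Nat.choose_succ_right_eq (2 * m + 1) (m + k + 1))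
      rw [show 2 * m + 1 - (m + k + 1) = m - k by lia] at e
      push_cast [Nat.cast_sub h] at e
      linear_combination e
    · rw [Nat.choose_eq_zero_of_lt (by lia), Nat.choose_eq_zero_of_lt (by lia)]
      simp
  field_simp
  linear_combination -ratio

theorem ballotFunctional_X_add_two_pow_succ (k m : ℕ) :
    ballotFunctional (k + 1) ((X + 2) ^ (m + 1)) =
      (2 * k + 2) / (m + k + 2) * (2 * m + 1).choose (m + k + 1) := by
  rw [ballotFunctional_eq_coeff _ (aeval_X_add_two_pow_succ m), mul_left_comm, coeff_T_mul,
    sub_one_mul, AddMonoidAlgebra.coeff_sub, Finsupp.sub_apply, coeff_T_mul,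
    show ((k + 1 : ℕ) : ℤ) - -(m + 1) - 1 = (m + k + 1 : ℕ) by push_cast; ring,
    show ((k + 1 : ℕ) : ℤ) - -(m + 1) = (m + k + 2 : ℕ) by push_cast; ring,
    coeff_T_one_add_one_pow, coeff_T_one_add_one_pow, ballot_choose_sub]

theorem ballotHankel_apply (n k : ℕ) (i j : Fin n) :
    ballotHankel n k i j = ballotFunctional (k + 1) ((X + 2) ^ (i : ℕ) * (X + 2) ^ (j : ℕ)) := by
  rw [ballotHankel, Matrix.of_apply, ← pow_add]
  split_ifs with h
  · rw [h.1, h.2, pow_zero, ballotFunctional_one k.succ_pos]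
  · obtain ⟨m, hm⟩ : ∃ m, (i : ℕ) + j = m + 1 := ⟨(i : ℕ) + j - 1, by lia⟩
    have hm' : ((i : ℕ) : ℚ) + (j : ℕ) = m + 1 := by exact_mod_cast hm
    rw [hm, hm', ballotFunctional_X_add_two_pow_succ,
      show 2 * (i : ℕ) + 2 * (j : ℕ) - 1 = 2 * m + 1 by lia,
      show m + 1 + k = m + k + 1 by ring]
    congr 2
    ring

end Functional

section SparseBases

open Polynomial LaurentPolynomial

/-- The row basis: the monic polynomial of degree `i` which, for `i ≠ 0`, becomes
`(T + 1) * (T ^ (i - 1) + T ^ (-i))` under `X = T + T⁻¹`. -/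
noncomputable def rowPoly : ℕ → ℚ[X]
  | 0 => 1
  | i + 1 => Chebyshev.C ℚ (i + 1 : ℕ) + Chebyshev.C ℚ i

/-- The column basis: the monic polynomial of degree `a * K + b` which becomes
`(T ^ ((a+1) * K) - T ^ (-(a+1) * K)) / (T ^ K - T ^ (-K)) * (T ^ (b+1) - T ^ (-b)) / (T - 1)`
under `X = T + T⁻¹`. -/
noncomputable def blockPoly (K a b : ℕ) : ℚ[X] :=
  (Chebyshev.S ℚ a).comp (Chebyshev.C ℚ K) * (Chebyshev.S ℚ b + Chebyshev.S ℚ (b - 1))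

theorem isMonicOfDegree_rowPoly (i : ℕ) : IsMonicOfDegree (rowPoly i) i := by
  obtain _ | _ | i := i
  · simp [rowPoly]
  · rw [rowPoly, zero_add, Nat.cast_one, Nat.cast_zero, Chebyshev.C_one, Chebyshev.C_zero]
    exact isMonicOfDegree_X_add_one (2 : ℚ)
  · refine (isMonicOfDegree_chebyshevC ℚ (by lia)).add_right ?_
    rw [(isMonicOfDegree_chebyshevC ℚ (by lia)).natDegree_eq]
    lia

theorem isMonicOfDegree_blockPoly {K : ℕ} (hK : 0 < K) (a b : ℕ) :
    IsMonicOfDegree (blockPoly K a b) (a * K + b) := by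
  refine ((isMonicOfDegree_chebyshevS ℚ a).comp hK.ne'
    (isMonicOfDegree_chebyshevC ℚ hK.ne')).mul ?_
  obtain _ | b := b
  · simp
  · refine (isMonicOfDegree_chebyshevS ℚ (b + 1)).add_right ?_
    rw [Nat.cast_succ, add_sub_cancel_right, (isMonicOfDegree_chebyshevS ℚ b).natDegree_eq]
    exact b.lt_succ_self

theorem aeval_rowPoly_succ (i : ℕ) :
    aeval (T 1 + T (-1)) (rowPoly (i + 1)) =
      (T 1 + 1) * (T i + T (-i - 1) : ℚ[T;T⁻¹]) := by
  rw [rowPoly, map_add, aeval_add_chebyshevC (T_mul_T_neg 1), aeval_add_chebyshevC (T_mul_T_neg 1)]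
  simp only [T_pow, T_sub, pow_succ, mul_one, mul_neg]
  linear_combination -T (-i) * T_mul_T_neg (R := ℚ) 1

theorem sub_one_mul_aeval_blockPoly (K a b : ℕ) :
    (T 1 - 1) * aeval (T 1 + T (-1)) (blockPoly K a b) =
      aeval (T K + T (-K)) (Chebyshev.S ℚ a) * (T (b + 1) - T (-b) : ℚ[T;T⁻¹]) := by
  have h := sub_one_mul_aeval_add_chebyshevS (R := ℚ) (T_mul_T_neg (R := ℚ) 1) b
  rw [T_pow, T_pow, mul_one, mul_neg_one, Nat.cast_succ] at h
  rw [blockPoly, map_mul, aeval_comp, aeval_add_chebyshevC (T_mul_T_neg 1), T_pow, T_pow, mul_one,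
    mul_neg_one, ← h]
  ring

theorem ballotFunctional_rowPoly_succ_mul_blockPoly {K b : ℕ} (hb : b < K) (a i : ℕ) :
    ballotFunctional K (rowPoly (i + 1) * blockPoly K a b) =
      (if i + b + 1 = (a + 1) * K then 1 else 0) - if i = (a + 1) * K + b then 1 else 0 := by
  set h : ℚ[T;T⁻¹] := (T i + T (-i - 1)) * (T (b + 1) - T (-b)) with h_def
  have invert_h : invert h = -h := by
    rw [h_def]
    simp only [map_mul, map_add, map_sub, invert_T, T_sub, T_add, neg_neg]
    linear_combination (T (-i) * T b + T i * T (-b)) * T_mul_T_neg (R := ℚ) 1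
  have factor : aeval (T 1 + T (-1) : ℚ[T;T⁻¹]) (rowPoly (i + 1) * blockPoly K a b) =
      (T 1 + 1) * ((T i + T (-i - 1)) * aeval (T 1 + T (-1)) (blockPoly K a b)) := by
    rw [map_mul, aeval_rowPoly_succ, mul_assoc]
  have : (K : ℤ) ≤ (a + 1) * K := by nlinarith
  rw [ballotFunctional_eq_coeff K factor, mul_left_comm, sub_one_mul_aeval_blockPoly, mul_left_comm,
    coeff_mul_aeval_chebyshevS invert_h, h_def, mul_sub, add_mul, add_mul, ← T_add, ← T_add,
    ← T_add, ← T_add]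
  simp only [AddMonoidAlgebra.coeff_sub, AddMonoidAlgebra.coeff_add, Finsupp.sub_apply,
    Finsupp.add_apply, T_apply]
  rw [if_neg (by lia : ¬ -(i : ℤ) - 1 + (b + 1) = (a + 1) * K),
    if_neg (by lia : ¬ -(i : ℤ) - 1 + -b = (a + 1) * K), add_zero, add_zero]
  zify
  simp only [← add_assoc, ← sub_eq_add_neg, sub_eq_iff_eq_add]

theorem ballotFunctional_blockPoly_eq (K a b : ℕ) :
    ballotFunctional K (blockPoly K a b) = nonnegPartEvalNegOne
      (aeval (T K + T (-K)) (Chebyshev.S ℚ a) * (T (b - K) - T (-b - K - 1))) := by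
  rw [ballotFunctional_apply, mul_assoc, sub_one_mul_aeval_blockPoly, mul_left_comm, mul_sub,
    ← T_add, ← T_add, show (-K - 1 + (b + 1) : ℤ) = b - K by ring,
    show (-K - 1 + -b : ℤ) = -b - K - 1 by ring]

theorem nonnegPartEvalNegOne_T_add_T_neg_mul {K b : ℕ} (hb : b < K) {n : ℤ} (hn : K ≤ n) :
    nonnegPartEvalNegOne ((T n + T (-n)) * (T (b - K) - T (-b - K - 1))) =
      (-1) ^ (n - K + b) - if 0 ≤ n - K - b - 1 then (-1) ^ (n - K - b - 1) else 0 := by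
  have expand : (T n + T (-n) : ℚ[T;T⁻¹]) * (T (b - K) - T (-b - K - 1)) =
      T (n - K + b) - T (n - K - b - 1) + (T (-n - K + b) - T (-n - K - b - 1)) := by
    rw [add_mul, mul_sub, mul_sub, ← T_add, ← T_add, ← T_add, ← T_add]
    ring_nf
  rw [expand, map_add, map_sub, map_sub]
  simp only [nonnegPartEvalNegOne_T]
  rw [if_pos (by lia : 0 ≤ n - K + b), if_neg (by lia : ¬ 0 ≤ -n - K + b),
    if_neg (by lia : ¬ 0 ≤ -n - K - b - 1), sub_zero, add_zero]

theorem ballotFunctional_blockPoly {K b : ℕ} (hb : b < K) (a : ℕ) :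
    ballotFunctional K (blockPoly K a b) = (-1) ^ ((a + 1) * K + b) * a := by
  rw [ballotFunctional_blockPoly_eq]
  induction a using Nat.twoStepInduction with
  | zero =>
    rw [Nat.cast_zero, Chebyshev.S_zero, map_one, one_mul, map_sub, nonnegPartEvalNegOne_T,
      nonnegPartEvalNegOne_T, if_neg (by lia), if_neg (by lia), sub_zero, Nat.cast_zero, mul_zero]
  | one =>
    rw [Nat.cast_one, Chebyshev.S_one, aeval_X, nonnegPartEvalNegOne_T_add_T_neg_mul hb le_rfl,
      if_neg (by lia)]
    simp [pow_add, pow_mul]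
  | more a ih _ =>
    have : (K : ℤ) ≤ (a + 1) * K := by nlinarith
    have aeval_C : aeval (T K + T (-K)) (Chebyshev.C ℚ (a + 2)) =
        (T ((a + 2) * K) + T (-((a + 2) * K)) : ℚ[T;T⁻¹]) := by
      have h := aeval_add_chebyshevC (R := ℚ) (T_mul_T_neg (R := ℚ) K) (a + 2)
      rw [T_pow, T_pow, mul_neg] at h
      exact_mod_cast h
    have sign : (-1 : ℚ) ^ ((a + 1) * K - b - 1 : ℤ) = -(-1) ^ ((a + 1) * K + b : ℤ) := by
      rw [show ((a + 1) * K + b : ℤ) = (a + 1) * K - b - 1 + 1 + 2 * b by ring,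
        zpow_add₀ (by norm_num), zpow_add_one₀ (by norm_num), zpow_mul]
      simp
    have natCast_exponent : ((a + 1) * K + b : ℤ) = ((a + 1) * K + b : ℕ) := by push_cast; rfl
    rw [Nat.cast_add, Nat.cast_ofNat, chebyshevS_add_two, map_add, add_mul, map_add, ih, aeval_C,
      nonnegPartEvalNegOne_T_add_T_neg_mul hb (by lia), show (a + 2 : ℤ) * K - K = (a + 1) * K by
      ring, if_pos (by lia), sign, natCast_exponent, zpow_natCast,
      show (a + 2 + 1) * K + b = (a + 1) * K + b + 2 * K by ring, pow_add _ _ (2 * K), pow_mul _ 2,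
      neg_one_sq, one_pow]
    push_cast
    ring

end SparseBases

section Gram

open Matrix Polynomial

/-- The Gram matrix, of unbounded size, of `ballotFunctional K` between the bases `rowPoly` (rows)
and `blockPoly` (columns, where column `j` lies at place `j % K` of block `j / K`). -/
noncomputable def ballotGram (K i j : ℕ) : ℚ :=
  ballotFunctional K (rowPoly i * blockPoly K (j / K) (j % K))

theorem det_ballotHankel_eq (n k : ℕ) :
    (ballotHankel n k).det = (of fun i j : Fin n => ballotGram (k + 1) i j).det := by
  let B : ℚ[X] →ₗ[ℚ] ℚ[X] →ₗ[ℚ] ℚ := (LinearMap.mul ℚ ℚ[X]).compr₂ (ballotFunctional (k + 1))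
  have shifted (i : Fin n) : IsMonicOfDegree ((X + 2 : ℚ[X]) ^ (i : ℕ)) i := by
    simpa only [map_ofNat, one_mul] using (isMonicOfDegree_X_add_one (2 : ℚ)).pow (i : ℕ)
  have block (j : Fin n) :
      IsMonicOfDegree (blockPoly (k + 1) ((j : ℕ) / (k + 1)) ((j : ℕ) % (k + 1))) j := by
    simpa only [Nat.div_add_mod'] using isMonicOfDegree_blockPoly k.succ_pos
      ((j : ℕ) / (k + 1)) ((j : ℕ) % (k + 1))
  calc (ballotHankel n k).det
      = (of fun i j : Fin n => B ((X + 2) ^ (i : ℕ)) ((X + 2) ^ (j : ℕ))).det := by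
        congr 1
        ext i j
        exact ballotHankel_apply n k i j
    _ = (of fun i j : Fin n => B (X ^ (i : ℕ)) (X ^ (j : ℕ))).det :=
        det_linearMap₂_isMonicOfDegree B shifted shifted
    _ = _ := (det_linearMap₂_isMonicOfDegree B (fun i => isMonicOfDegree_rowPoly i) block).symm

variable {K : ℕ}

theorem ballotGram_zero_mul (hK : 0 < K) (m : ℕ) :
    ballotGram K 0 (m * K) = (-1) ^ ((m + 1) * K) * m := by
  rw [ballotGram, rowPoly, one_mul, Nat.mul_div_cancel _ hK, Nat.mul_mod_left,
    ballotFunctional_blockPoly hK, add_zero]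

theorem ballotGram_succ (hK : 0 < K) (i j : ℕ) :
    ballotGram K (i + 1) j = (if i + j % K + 1 = (j / K + 1) * K then 1 else 0) -
      if i = (j / K + 1) * K + j % K then 1 else 0 :=
  ballotFunctional_rowPoly_succ_mul_blockPoly (Nat.mod_lt j hK) (j / K) i

theorem ballotGram_eq_zero {i m b : ℕ} (hb : b < K) (hi : i ≠ 0) (h : i + b < (m + 1) * K) :
    ballotGram K i (m * K + b) = 0 := by
  obtain ⟨i, rfl⟩ := Nat.exists_eq_add_one_of_ne_zero hi
  have hdiv : (m * K + b) / K = m := Nat.div_eq_of_lt_le (by lia) (by lia)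
  rw [ballotGram_succ (by lia), hdiv, Nat.mul_add_mod_of_lt hb,
    if_neg (by lia), if_neg (by lia), sub_zero]

theorem ballotGram_mul_eq_zero {i m : ℕ} (hi : i ≠ 0) (h : i < (m + 1) * K) :
    ballotGram K i (m * K) = 0 :=
  ballotGram_eq_zero (b := 0) (Nat.pos_of_mul_pos_left (i.zero_le.trans_lt h)) hi h

theorem ballotGram_succ_mul_mul (hK : 0 < K) (m : ℕ) : ballotGram K ((m + 1) * K) (m * K) = 1 := by
  obtain ⟨i, hi⟩ := Nat.exists_eq_add_one_of_ne_zero (mul_pos m.succ_pos hK).ne'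
  rw [hi, ballotGram_succ hK, Nat.mul_div_cancel _ hK, Nat.mul_mod_left,
    if_pos (by lia), if_neg (by lia), sub_zero]

theorem det_ballotGram_succ (hK : 0 < K) (m : ℕ) :
    (of fun i j : Fin (m * K) => ballotGram K (i + 1) j).det = (-1) ^ (m * K.choose 2) := by
  have hσ (j : Fin (m * K)) :
      (blockRevPerm m K j : ℕ) + (j : ℕ) % K + 1 = ((j : ℕ) / K + 1) * K := by
    have := Nat.mod_lt (j : ℕ) hK
    rw [blockRevPerm_val, add_one_mul]
    omega
  rw [det_eq_sign_of_triangular_comp_perm (blockRevPerm m K), sign_blockRevPerm]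
  · simp
  · intro j
    have := hσ j
    rw [of_apply, ballotGram_succ hK, if_pos this, if_neg (by lia), sub_zero]
  · intro i j hij
    have := hσ j
    have : (i : ℕ) < blockRevPerm m K j := hij
    rw [of_apply, ballotGram_succ hK, if_neg (by lia), if_neg (by lia), sub_zero]

theorem det_ballotGram_mul_add_one (hK : 0 < K) (m : ℕ) :
    (of fun i j : Fin (m * K + 1) => ballotGram K i j).det =
      (-1) ^ (m * K.choose 2 + K) * m := by
  rw [det_eq_of_column_eq_zero 0 (Fin.last _)]
  · have minor_eq : (of fun i j : Fin (m * K + 1) => ballotGram K i j).submatrix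
        (Fin.succAbove 0) (Fin.last _).succAbove =
          of fun i j : Fin (m * K) => ballotGram K (i + 1) j := by
      ext i j
      simp
    have parity : (-1 : ℚ) ^ (m * K) * (-1) ^ ((m + 1) * K) = (-1) ^ K := by
      rw [← pow_add, show m * K + (m + 1) * K = 2 * (m * K) + K by ring, pow_add, pow_mul]
      simp
    rw [minor_eq, det_ballotGram_succ hK, of_apply, Fin.val_zero, Fin.val_last, zero_add,
      ballotGram_zero_mul hK, pow_add, ← parity]
    ring
  · intro i hi
    exact ballotGram_mul_eq_zero (Fin.val_ne_zero_iff.mpr hi) (by lia)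

theorem det_ballotGram_succ_mul (hK : 0 < K) (m : ℕ) :
    (of fun i j : Fin ((m + 1) * K) => ballotGram K i j).det =
      (-1) ^ ((m + 1) * K.choose 2 + 1) * m := by
  have shifted_det := det_ballotGram_succ hK (m + 1)
  have entry := ballotGram_zero_mul hK m
  have last_entry := ballotGram_succ_mul_mul hK m
  have column (i : ℕ) (hi : i ≠ 0) (h : i < (m + 1) * K) : ballotGram K i (m * K) = 0 :=
    ballotGram_mul_eq_zero hi h
  have hmK : m * K < (m + 1) * K := by lia
  obtain ⟨N, hN⟩ := Nat.exists_eq_add_one_of_ne_zero (mul_pos m.succ_pos hK).ne'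
  have sign : (-1 : ℚ) ^ N * (-1) ^ N = 1 := by rw [← mul_pow]; simp
  rw [hN] at shifted_det entry last_entry column hmK ⊢
  rw [det_eq_of_row_shift (B := of fun i j : Fin (N + 1) => ballotGram K (i + 1) j)
    (fun i j => by simp) ⟨m * K, hmK⟩, shifted_det, of_apply, Fin.val_zero, entry, pow_succ,
    pow_succ]
  · linear_combination (-1 : ℚ) ^ ((m + 1) * K.choose 2) * -m * sign
  · exact fun i hi => column i (Fin.val_ne_zero_iff.mpr hi) i.2
  · exact fun i hi => column (i + 1) (by lia) (by have := Fin.val_lt_last hi; lia)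
  · exact last_entry

theorem det_ballotGram_eq_zero {c : ℕ} (m : ℕ) (hc : 2 ≤ c) (hcK : c < K) :
    (of fun i j : Fin (m * K + c) => ballotGram K i j).det = 0 := by
  let column (b : ℕ) (hb : b < 2) : Fin (m * K + c) := ⟨m * K + b, by lia⟩
  have column_zero (b : ℕ) (hb : b < 2) (i : Fin (m * K + c)) (hi : i ≠ ⟨0, by lia⟩) :
      ballotGram K i (column b hb) = 0 :=
    ballotGram_eq_zero (by lia) (fun h => hi (Fin.ext h)) (by lia)
  exact det_eq_zero_of_two_columns (c := column 0 two_pos) (d := column 1 one_lt_two)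
    (by simp [column]) _ (column_zero 0 two_pos) (column_zero 1 one_lt_two)

end Gram

theorem theorem19 (n k : ℕ) (hn : 1 ≤ n) :
    (∀ n₁ : ℕ, n = (k + 1) * n₁ →
      (ballotHankel n k).det = (-1 : ℚ) ^ (n₁ * Nat.choose (k + 1) 2 + 1) * ((n₁ : ℚ) - 1)) ∧
    (∀ n₁ : ℕ, n = (k + 1) * n₁ + 1 →
      (ballotHankel n k).det = (-1 : ℚ) ^ (n₁ * Nat.choose (k + 1) 2 + k + 1) * (n₁ : ℚ)) ∧
    (¬ n ≡ 0 [MOD k + 1] → ¬ n ≡ 1 [MOD k + 1] → (ballotHankel n k).det = 0) := by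
  rw [det_ballotHankel_eq]
  refine ⟨?_, ?_, ?_⟩
  · rintro n₁ rfl
    obtain ⟨m, rfl⟩ : ∃ m, n₁ = m + 1 := Nat.exists_eq_add_one_of_ne_zero (by rintro rfl; lia)
    rw [mul_comm (k + 1), det_ballotGram_succ_mul k.succ_pos, Nat.cast_succ, add_sub_cancel_right]
  · rintro n₁ rfl
    rw [mul_comm (k + 1), det_ballotGram_mul_add_one k.succ_pos, add_assoc]
  · intro h₀ h₁
    have hlt : n % (k + 1) < k + 1 := Nat.mod_lt n k.succ_pos
    have ne_zero : n % (k + 1) ≠ 0 := fun h => h₀ (by rw [Nat.ModEq, h, Nat.zero_mod])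
    have ne_one : n % (k + 1) ≠ 1 := fun h => h₁ (by
      rw [Nat.ModEq, h, Nat.mod_eq_of_lt (h.symm.trans_lt hlt)])
    rw [← Nat.div_add_mod' n (k + 1)]
    exact det_ballotGram_eq_zero _ (by lia) hlt
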